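/- Consider the stochastic bandit with $d$ arms and unknown mean vector $\mu\in\mathbb R^d$: in each round $t=1,2,\dots$ a strategy $\pi$ chooses an arm $I_t\in\{1,\dots,d\}$ based on the past arms and rewards (possibly with additional randomisation) and then receives a reward $X_t$ whose conditional law given the past and $I_t$ is $\mathcal N(\mu_{I_t},1)$. Write $\mu^*=\max_i\mu_i$, $\Delta_i=\mu^*-\mu_i$, and let $R^\pi_\mu(n)=\mathbb E\big[\sum_{t=1}^n(\mu^*-\mu_{I_t})\big]$ be the expected regret of $\pi$ up to horizon $n$. For $\nu\in\mathbb R$, $\sigma^2\ge 0$ and an integer $m\ge 1$ let $\theta\sim\mathcal N(\nu,\sigma^2)$ and, conditionally on $\theta$, let $Y_1,\dots,Y_m$ be independent with law $\mathcal N(\theta,1)$. The Gittins index is $$\gamma(\nu,\sigma^2,m)=\max\Big\{\gamma\in\mathbb R:\ \sup_{1\le\tau\le m}\mathbb E[(\theta-\gamma)\tau]\ge 0\Big\},$$ where the supremum is over stopping times $\tau$ with respect to the filtration generated by $Y_1,\dots,Y_m$. Fix a Gaussian prior with independent components $\mathcal N(\nu_i,\sigma_i^2)$, $i=1,\dots,d$.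 Let $T_i(t)=\sum_{s\le t}\mathbf 1\{I_s=i\}$ and let $$\nu_i(t)=\frac{\nu_i/\sigma_i^2+\sum_{s=1}^t\mathbf 1\{I_s=i\}X_s}{1/\sigma_i^2+T_i(t)},\qquad \sigma_i^2(t)=\Big(\frac1{\sigma_i^2}+T_i(t)\Big)^{-1}$$ be the posterior mean and variance of arm $i$ after round $t$. For each horizon $n$ let $\pi_n$ be a strategy that chooses $$I_t\in\operatorname*{arg\,max}_i\ \gamma\big(\nu_i(t-1),\sigma_i^2(t-1),n-t+1\big)\qquad (1\le t\le n),$$ with ties broken in any way. Theorem. There is a universal constant $c>0$ such that for every $d$, every prior with $\nu_i\in\mathbb R$ and $\sigma_i^2>0$ for all $i$, every such sequence of strategies $(\pi_n)_n$, and every $\mu\in\mathbb R^d$, $$\limsup_{n\to\infty}\frac{R^{\pi_n}_\mu(n)}{\log n}\ \le\ c\sum_{i:\Delta_i>0}\frac1{\Delta_i}.$$ -/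

import Mathlib

open MeasureTheory ProbabilityTheory Filter
open scoped NNReal

noncomputable section

namespace GaussianBandit

/-! ### The finite-horizon Gittins index -/

/-- The joint law of `(θ, (Y₁, …, Y_m))`, where `θ ∼ N(ν, v)` and, conditionally on `θ`, the rewards
`Y₁, …, Y_m` are independent with law `N(θ, 1)` (that is, `Y_s = θ + ξ_s` with independent standard
Gaussian `ξ_s`, also independent of `θ`). The reward `Y_{s+1}` is the coordinate `s : Fin m`. -/
def armLaw (ν : ℝ) (v : ℝ≥0) (m : ℕ) : Measure (ℝ × (Fin m → ℝ)) :=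
  ((gaussianReal ν v).prod (Measure.pi fun _ : Fin m => gaussianReal 0 1)).map
    fun p => (p.1, fun s => p.1 + p.2 s)

/-- The filtration generated by the rewards: at time `t` it is `σ(Y₁, …, Y_t)`. -/
def rewardFiltration (m : ℕ) :
    Filtration ℕ (inferInstance : MeasurableSpace (ℝ × (Fin m → ℝ))) where
  seq t := ⨆ (s : Fin m) (_ : (s : ℕ) < t),
    MeasurableSpace.comap (fun p : ℝ × (Fin m → ℝ) => p.2 s) inferInstance
  mono' := fun _ _ h => iSup_mono fun _ => iSup_mono' fun hs => ⟨hs.trans_le h, le_rfl⟩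
  le' := fun _ => iSup₂_le fun s _ =>
    ((measurable_pi_apply s).comp measurable_snd).comap_le

/-- Stopping times `τ` of the reward filtration with `1 ≤ τ ≤ m`. -/
structure IsAdmissible (m : ℕ) (τ : ℝ × (Fin m → ℝ) → ℕ) : Prop where
  isStoppingTime : IsStoppingTime (rewardFiltration m) fun p => (τ p : WithTop ℕ)
  one_le : ∀ p, 1 ≤ τ p
  le : ∀ p, τ p ≤ m

/-- `sup_{1 ≤ τ ≤ m} E[(θ - γ) τ]`, over stopping times of the reward filtration. -/
def stoppingValue (ν : ℝ) (v : ℝ≥0) (m : ℕ) (γ : ℝ) : ℝ :=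
  ⨆ τ : {τ : ℝ × (Fin m → ℝ) → ℕ // IsAdmissible m τ},
    ∫ p, (p.1 - γ) * (τ.1 p : ℝ) ∂(armLaw ν v m)

/-- The Gittins index `max {γ : sup_{1 ≤ τ ≤ m} E[(θ - γ) τ] ≥ 0}` of an arm with posterior mean `ν`
and posterior variance `v` when `m ≥ 1` rounds remain. -/
def gittinsIndex (ν : ℝ) (v : ℝ≥0) (m : ℕ) : ℝ :=
  sSup {γ : ℝ | 0 ≤ stoppingValue ν v m γ}

/-! ### The bandit problem -/

/-- A history of length `t`: the arms chosen and the rewards received in the first `t` rounds. -/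
abbrev History (d t : ℕ) : Type := Fin t → Fin d × ℝ

/-- A (possibly randomised) strategy for a `d`-armed bandit: for each `t`, the law of the arm chosen
in round `t + 1`, given the history of the first `t` rounds. -/
structure Strategy (d : ℕ) where
  act : (t : ℕ) → Kernel (History d t) (Fin d)
  isMarkovKernel : ∀ t, IsMarkovKernel (act t)

attribute [instance] Strategy.isMarkovKernel

/-- Choosing arm `i` yields a reward with law `N(μ i, 1)`. -/
def rewardKernel {d : ℕ} (μ : Fin d → ℝ) : Kernel (Fin d) ℝ :=
  Kernel.ofFunOfCountable fun i => gaussianReal (μ i) 1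

instance {d : ℕ} (μ : Fin d → ℝ) : IsMarkovKernel (rewardKernel μ) :=
  ⟨fun i => inferInstanceAs (IsProbabilityMeasure (gaussianReal (μ i) 1))⟩

/-- The law of the history of the first `t` rounds, when the strategy `π` is used in the bandit with
mean vector `μ`. In each round an arm is drawn from the strategy given the past, then a reward is
drawn given the arm, and both are appended to the history. -/
def historyLaw {d : ℕ} (π : Strategy d) (μ : Fin d → ℝ) : (t : ℕ) → Measure (History d t)
  | 0 => Measure.dirac Fin.elim0
  | t + 1 =>
      ((historyLaw π μ t) ⊗ₘ
        ((π.act t) ⊗ₖ (Kernel.prodMkLeft (History d t) (rewardKernel μ)))).map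
        fun p => (Fin.snoc p.1 p.2 : History d (t + 1))

lemma measurable_snoc (d t : ℕ) :
    Measurable fun p : History d t × (Fin d × ℝ) => (Fin.snoc p.1 p.2 : History d (t + 1)) := by
  refine measurable_pi_lambda _ fun s => ?_
  refine Fin.lastCases ?_ (fun s => ?_) s
  · simpa using measurable_snd
  · have h : Measurable fun p : History d t × (Fin d × ℝ) => p.1 s :=
      (measurable_pi_apply s).comp measurable_fst
    simpa using h

instance isProbabilityMeasure_historyLaw {d : ℕ} (π : Strategy d) (μ : Fin d → ℝ) :
    (t : ℕ) → IsProbabilityMeasure (historyLaw π μ t)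
  | 0 => inferInstanceAs (IsProbabilityMeasure (Measure.dirac _))
  | t + 1 => by
    have := isProbabilityMeasure_historyLaw π μ t
    exact Measure.isProbabilityMeasure_map (measurable_snoc d t).aemeasurable

/-- The gap `Δ_i = max_j μ_j - μ_i`. -/
def gap {d : ℕ} (μ : Fin d → ℝ) (i : Fin d) : ℝ := (⨆ j, μ j) - μ i

/-- The expected regret of `π` up to horizon `n` in the bandit with mean vector `μ`. -/
def regret {d : ℕ} (π : Strategy d) (μ : Fin d → ℝ) (n : ℕ) : ℝ :=
  ∫ h, ∑ t, gap μ (h t).1 ∂(historyLaw π μ n)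

/-! ### The Gittins index strategy for a Gaussian prior -/

/-- The number of times that arm `i` was chosen. -/
def pulls {d t : ℕ} (h : History d t) (i : Fin d) : ℕ :=
  ∑ s, if (h s).1 = i then 1 else 0

/-- The sum of the rewards received from arm `i`. -/
def rewardSum {d t : ℕ} (h : History d t) (i : Fin d) : ℝ :=
  ∑ s, if (h s).1 = i then (h s).2 else 0

/-- The posterior mean of arm `i` for the prior `N(ν i, v i)`. -/
def posteriorMean {d t : ℕ} (ν : Fin d → ℝ) (v : Fin d → ℝ≥0) (h : History d t) (i : Fin d) : ℝ :=
  (ν i / v i + rewardSum h i) / (1 / v i + pulls h i)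

/-- The posterior variance of arm `i` for the prior `N(ν i, v i)`. -/
def posteriorVar {d t : ℕ} (v : Fin d → ℝ≥0) (h : History d t) (i : Fin d) : ℝ≥0 :=
  (1 / v i + pulls h i)⁻¹

/-- The Gittins index of arm `i` after the history `h` of `t < n` rounds at horizon `n`, when there
are `n - t` rounds remaining. -/
def armIndex {d t : ℕ} (ν : Fin d → ℝ) (v : Fin d → ℝ≥0) (n : ℕ) (h : History d t) (i : Fin d) : ℝ :=
  gittinsIndex (posteriorMean ν v h i) (posteriorVar v h i) (n - t)

/-- `π` is a Gittins index strategy with horizon `n` for the prior with independent components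
`N(ν i, v i)`: in each of the rounds `1, …, n` it chooses an arm of maximal index. Ties may be broken
in any way, possibly at random. -/
def IsGittinsStrategy {d : ℕ} (ν : Fin d → ℝ) (v : Fin d → ℝ≥0) (n : ℕ) (π : Strategy d) : Prop :=
  ∀ t < n, ∀ h : History d t, ∀ᵐ i ∂(π.act t h), ∀ j, armIndex ν v n h j ≤ armIndex ν v n h i

end GaussianBandit

end

/-!
Let `i` be a suboptimal arm with gap `D` and let `k` be an optimal arm.

Bounding every stopping time by `m` whenever `θ > γ` shows that the index of an arm is at most its
posterior mean plus `√(2 log n)` posterior standard deviations. Hence, once arm `i` has been pulled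
more than `32 log n / D ^ 2 + O(1)` times, its index exceeds `μ k - D / 2` only if its rewards
deviate from their mean by a multiple of `D` per pull, which happens for `O(1)` pulls in
expectation.

If arm `i` is pulled although its index is less than `μ k - D / 2`, then so is the index of arm `k`.
The rule that looks at about `x ^ 2 / v` rewards and continues to the end if the posterior mean has
increased enough shows that the index of an arm with posterior mean `ν` and posterior variance `v`
is at least `ν + √v * x` unless the number of remaining rounds is at most `exp (x ^ 2 / 2)` up to
lower order factors. So arm `k` can fail after its `s`-th pull only during the last
`exp (x ^ 2 / 2 + o(x ^ 2))` rounds, where `x` is the standardised distance of its posterior mean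
from `μ k - D / 2`. The Gaussian density of its rewards contains a factor `exp (-s * D ^ 2 / 8)`
beyond the one that compensates this bound, so the expected number of failures is summable over
`s`.
-/

open scoped ENNReal

namespace GaussianBandit

section MeanExcess

/-- The mean excess `E (X - a)⁺` over the level `a` of a random variable `X` with law `P`. -/
noncomputable def meanExcess (P : Measure ℝ) (a : ℝ) : ℝ := ∫ x, max (x - a) 0 ∂P

lemma meanExcess_le_mgf {P : Measure ℝ} {l : ℝ} (hl : 0 < l)
    (hP : Integrable (fun x => Real.exp (l * x)) P) (a : ℝ) :
    meanExcess P a ≤ Real.exp (-(l * a)) * mgf id P l / l := by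
  have hle (x : ℝ) : max (x - a) 0 ≤ Real.exp (-(l * a)) / l * Real.exp (l * x) := by
    rw [div_mul_eq_mul_div, ← Real.exp_add, le_div_iff₀ hl, max_mul_of_nonneg _ _ hl.le, zero_mul]
    refine max_le ?_ (Real.exp_pos _).le
    linarith [Real.add_one_le_exp (-(l * a) + l * x)]
  calc meanExcess P a ≤ ∫ x, Real.exp (-(l * a)) / l * Real.exp (l * x) ∂P :=
        integral_mono_of_nonneg (.of_forall fun x => le_max_right _ _) (hP.const_mul _)
          (.of_forall hle)
    _ = Real.exp (-(l * a)) * mgf id P l / l := by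
        rw [integral_const_mul, div_mul_eq_mul_div]; rfl

lemma meanExcess_gaussianReal_le (μ : ℝ) (v : ℝ≥0) {l : ℝ} (hl : 0 < l) (a : ℝ) :
    meanExcess (gaussianReal μ v) a ≤ Real.exp (l * (μ - a) + v * l ^ 2 / 2) / l := by
  refine (meanExcess_le_mgf hl (integrable_exp_mul_gaussianReal l) a).trans_eq ?_
  rw [mgf_id_gaussianReal, ← Real.exp_add]
  ring_nf

lemma integrable_id_gaussianReal (μ : ℝ) (v : ℝ≥0) : Integrable (fun x => x) (gaussianReal μ v) :=
  (memLp_id_gaussianReal 1).integrable le_rfl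

lemma gaussianPDFReal_antitoneOn (μ : ℝ) (v : ℝ≥0) :
    AntitoneOn (gaussianPDFReal μ v) (Set.Ici μ) := by
  intro x hx y _ hxy
  rw [gaussianPDFReal, gaussianPDFReal]
  gcongr
  exact sub_nonneg.2 hx

/-- The excess is at least `c` on the interval `[a + c, a + 2 * c]`. -/
lemma sq_mul_gaussianPDFReal_le_meanExcess {μ : ℝ} {v : ℝ≥0} (hv : v ≠ 0) {a c : ℝ} (ha : μ ≤ a)
    (hc : 0 ≤ c) :
    c ^ 2 * gaussianPDFReal μ v (a + 2 * c) ≤ meanExcess (gaussianReal μ v) a := by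
  have hint : Integrable (fun x => max (x - a) 0) (gaussianReal μ v) :=
    ((integrable_id_gaussianReal μ v).sub (integrable_const a)).pos_part
  have hint' : Integrable (fun x => gaussianPDFReal μ v x * max (x - a) 0) := by
    rw [gaussianReal_of_var_ne_zero μ hv, integrable_withDensity_iff_integrable_smul'
      (measurable_gaussianPDF μ v) (.of_forall fun _ => gaussianPDF_lt_top)] at hint
    simpa only [toReal_gaussianPDF, smul_eq_mul] using hint
  have hle (x : ℝ) (hx : x ∈ Set.Icc (a + c) (a + 2 * c)) :
      gaussianPDFReal μ v (a + 2 * c) * c ≤ gaussianPDFReal μ v x * max (x - a) 0 :=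
    mul_le_mul
      (gaussianPDFReal_antitoneOn μ v (Set.mem_Ici.2 (by linarith [hx.1]))
        (Set.mem_Ici.2 (by linarith)) hx.2)
      (le_max_of_le_left (by linarith [hx.1])) hc (gaussianPDFReal_nonneg _ _ _)
  calc c ^ 2 * gaussianPDFReal μ v (a + 2 * c)
      = ∫ _ in Set.Icc (a + c) (a + 2 * c), gaussianPDFReal μ v (a + 2 * c) * c := by
        rw [setIntegral_const, Real.volume_real_Icc_of_le (by linarith), smul_eq_mul]
        ring
    _ ≤ ∫ x in Set.Icc (a + c) (a + 2 * c), gaussianPDFReal μ v x * max (x - a) 0 :=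
        setIntegral_mono_on (integrableOn_const (by simp)) hint'.integrableOn measurableSet_Icc hle
    _ ≤ ∫ x, gaussianPDFReal μ v x * max (x - a) 0 :=
        setIntegral_le_integral hint' (.of_forall fun x =>
          mul_nonneg (gaussianPDFReal_nonneg _ _ _) (le_max_right _ _))
    _ = meanExcess (gaussianReal μ v) a := (integral_gaussianReal_eq_integral_smul hv).symm

end MeanExcess

section Posterior

variable {Ω : Type*} {mΩ : MeasurableSpace Ω} {P : Measure Ω}

lemma setIntegral_add_sub_eq_meanExcess [IsProbabilityMeasure P] {U R : Ω → ℝ}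
    (hind : IndepFun U R P) (hUm : Measurable U) (hU : Integrable U P) (hR : Integrable R P)
    (hR0 : ∫ ω, R ω ∂P = 0) (a : ℝ) :
    ∫ ω in {ω | a ≤ U ω}, (U ω + R ω - a) ∂P = meanExcess (P.map U) a := by
  have hA : MeasurableSet {ω | a ≤ U ω} := measurableSet_le measurable_const hUm
  have hUa : Integrable (fun ω => U ω - a) P := hU.sub (integrable_const a)
  have hR_zero : ∫ ω in {ω | a ≤ U ω}, R ω ∂P = 0 := by
    refine (Indep.setIntegral_eq_mul (X := R) (f := id) hUm.comap_le
      ((IndepFun_iff_Indep _ _ _).1 hind) hR.aemeasurable ⟨Set.Ici a, measurableSet_Ici, rfl⟩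
      (by fun_prop)).trans ?_
    simp only [id_eq, hR0, mul_zero]
  calc ∫ ω in {ω | a ≤ U ω}, (U ω + R ω - a) ∂P
      = ∫ ω in {ω | a ≤ U ω}, ((U ω - a) + R ω) ∂P := by simp only [add_sub_right_comm]
    _ = ∫ ω in {ω | a ≤ U ω}, (U ω - a) ∂P := by
        rw [integral_add hUa.integrableOn hR.integrableOn, hR_zero, add_zero]
    _ = ∫ ω, max (U ω - a) 0 ∂P := by
        rw [← integral_indicator hA]
        refine integral_congr_ae (.of_forall fun ω => ?_)
        by_cases h : a ≤ U ω
        · simp [h]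
        · simp [h, (not_le.1 h).le]
    _ = meanExcess (P.map U) a := by
        rw [meanExcess, integral_map hUm.aemeasurable (by fun_prop)]

lemma indepFun_sub_const_mul_of_covariance_eq {X Y : Ω → ℝ}
    (hXY : HasGaussianLaw (fun ω => (X ω, Y ω)) P) {ρ : ℝ} (hρ : cov[X, Y; P] = ρ * Var[Y; P]) :
    IndepFun Y (fun ω => X ω - ρ * Y ω) P := by
  have := hXY.isProbabilityMeasure
  have hY := hXY.snd.memLp_two
  have hYR : HasGaussianLaw (fun ω => (Y ω, X ω - ρ * Y ω)) P :=
    hXY.map_fun ((ContinuousLinearMap.snd ℝ ℝ ℝ).prod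
      (ContinuousLinearMap.fst ℝ ℝ ℝ - ρ • ContinuousLinearMap.snd ℝ ℝ ℝ))
  refine hYR.indepFun_of_covariance_eq_zero ?_
  rw [covariance_fun_sub_right hY hXY.fst.memLp_two (hY.const_mul ρ), covariance_const_mul_right,
    covariance_self hXY.snd.aemeasurable, covariance_comm, hρ, sub_self]

variable {θ N : Ω → ℝ} {ν : ℝ} {v u : ℝ≥0}

lemma hasLaw_posteriorMean (hθ : HasLaw θ (gaussianReal ν v) P)
    (hN : HasLaw N (gaussianReal 0 u) P) (hθN : IndepFun θ N P) :
    HasLaw (fun ω => v / (v + u) * (θ ω + N ω - ν)) (gaussianReal 0 (v ^ 2 / (v + u))) P := by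
  have hsum : HasLaw (fun ω => θ ω + N ω) (gaussianReal (ν + 0) (v + u)) P :=
    ⟨hθ.aemeasurable.add hN.aemeasurable,
      gaussianReal_add_gaussianReal_of_indepFun hθN hθ.map_eq hN.map_eq⟩
  convert gaussianReal_const_mul (gaussianReal_sub_const hsum ν) (v / (v + u) : ℝ) using 2
  · ring
  · apply NNReal.coe_injective
    push_cast
    by_cases h : (v + u : ℝ) = 0
    · simp [h]
    · field_simp

/-- The Bayes estimate of `θ` from `θ + N` has a residual that is independent of it, so on the event
that the estimate exceeds `ν + a` one may replace `θ` by the estimate. -/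
lemma setIntegral_posterior_eq_meanExcess (hvu : v + u ≠ 0) (hθm : Measurable θ)
    (hNm : Measurable N) (hθ : HasLaw θ (gaussianReal ν v) P)
    (hN : HasLaw N (gaussianReal 0 u) P) (hθN : IndepFun θ N P) (a : ℝ) :
    ∫ ω in {ω | a ≤ v / (v + u) * (θ ω + N ω - ν)}, (θ ω - (ν + a)) ∂P =
      meanExcess (gaussianReal 0 (v ^ 2 / (v + u))) a := by
  have := hθ.isProbabilityMeasure
  have hθN' : HasGaussianLaw (fun ω => (θ ω, N ω)) P :=
    hθN.hasGaussianLaw hθ.hasGaussianLaw hN.hasGaussianLaw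
  have hsum : HasGaussianLaw (fun ω => (θ ω, θ ω + N ω)) P :=
    hθN'.map_fun ((ContinuousLinearMap.fst ℝ ℝ ℝ).prod
      (ContinuousLinearMap.fst ℝ ℝ ℝ + ContinuousLinearMap.snd ℝ ℝ ℝ))
  have hU := hasLaw_posteriorMean hθ hN hθN
  set ρ : ℝ := v / (v + u)
  have hρ : cov[θ, fun ω => θ ω + N ω; P] = ρ * Var[fun ω => θ ω + N ω; P] := by
    have h2θ := hθN'.fst.memLp_two
    have h2N := hθN'.snd.memLp_two
    have hVθ : Var[θ; P] = v := by rw [hθ.variance_eq]; exact variance_id_gaussianReal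
    have hVN : Var[N; P] = u := by rw [hN.variance_eq]; exact variance_id_gaussianReal
    have hvu' : (v : ℝ) + u ≠ 0 := by exact_mod_cast hvu
    change cov[θ, θ + N; P] = ρ * Var[θ + N; P]
    rw [covariance_add_right h2θ h2θ h2N, hθN.covariance_eq_zero h2θ h2N,
      hθN.variance_add h2θ h2N, covariance_self hθm.aemeasurable, hVθ, hVN, add_zero,
      div_mul_cancel₀ _ hvu']
  have hind : IndepFun (fun ω => ρ * (θ ω + N ω - ν))
      (fun ω => θ ω - ν - ρ * (θ ω + N ω - ν)) P := by
    have hR : (fun ω => θ ω - ν - ρ * (θ ω + N ω - ν)) =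
        (fun x => x + (ρ * ν - ν)) ∘ fun ω => θ ω - ρ * (θ ω + N ω) := by
      ext ω
      simp only [Function.comp_apply]
      ring
    rw [hR]
    exact (indepFun_sub_const_mul_of_covariance_eq hsum hρ).comp (φ := fun x => ρ * (x - ν))
      (by fun_prop) (by fun_prop)
  have hUi : Integrable (fun ω => ρ * (θ ω + N ω - ν)) P := hU.hasGaussianLaw.integrable
  have hθi : Integrable (fun ω => θ ω - ν) P := hθN'.fst.integrable.sub (integrable_const ν)
  rw [← hU.map_eq, ← setIntegral_add_sub_eq_meanExcess hind (by fun_prop) hUi (hθi.sub hUi)]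
  · congr 1
    ext ω
    ring
  · rw [integral_sub hθi hUi, hU.integral_eq, integral_id_gaussianReal]
    rw [integral_sub hθN'.fst.integrable (integrable_const ν), hθ.integral_eq,
      integral_id_gaussianReal]
    simp

end Posterior

section Arm

variable {ν : ℝ} {v : ℝ≥0} {k m : ℕ}

instance isProbabilityMeasure_armLaw (ν : ℝ) (v : ℝ≥0) (m : ℕ) :
    IsProbabilityMeasure (armLaw ν v m) :=
  Measure.isProbabilityMeasure_map (by fun_prop)

/-- The average of the first `k` rewards, a function of the rewards `p.2` in the sample space of
`armLaw`. -/
noncomputable def sampleMean (k : ℕ) (p : ℝ × (Fin m → ℝ)) : ℝ :=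
  (∑ s : Fin m with s.val < k, p.2 s) / k

@[fun_prop]
lemma measurable_sampleMean : Measurable (sampleMean (m := m) k) := by
  unfold sampleMean
  fun_prop

lemma measurable_sampleMean_rewardFiltration :
    Measurable[rewardFiltration m k] (sampleMean (m := m) k) :=
  (Finset.measurable_sum _ fun s hs => (comap_measurable _).mono
    (le_iSup₂ (f := fun (s : Fin m) (_ : (s : ℕ) < k) =>
      MeasurableSpace.comap (fun p : ℝ × (Fin m → ℝ) => p.2 s) inferInstance)
      s (Finset.mem_filter.1 hs).2) le_rfl).div_const _

lemma hasLaw_sum_gaussianReal {ι : Type*} [Fintype ι] (S : Finset ι) :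
    HasLaw (fun ξ : ι → ℝ => ∑ i ∈ S, ξ i) (gaussianReal 0 S.card)
      (Measure.pi fun _ : ι => gaussianReal 0 1) := by
  classical
  refine ⟨by fun_prop, ?_⟩
  induction S using Finset.induction_on with
  | empty => simp [gaussianReal_zero_var]
  | insert i S hi ih =>
    have hind : IndepFun (fun ξ : ι → ℝ => ξ i) (∑ j ∈ S, fun ξ : ι → ℝ => ξ j)
        (Measure.pi fun _ : ι => gaussianReal 0 1) :=
      ((iIndepFun_pi (X := fun _ x => x) fun _ => aemeasurable_id).indepFun_finsetSum_of_notMem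
        (fun i => measurable_pi_apply i) hi).symm
    have hsum : (∑ j ∈ S, fun ξ : ι → ℝ => ξ j) = fun ξ => ∑ j ∈ S, ξ j := by
      ext ξ
      exact Finset.sum_apply _ _ _
    rw [hsum] at hind
    simp only [Finset.sum_insert hi]
    refine (gaussianReal_add_gaussianReal_of_indepFun hind
      (measurePreserving_eval _ i).map_eq ih).trans ?_
    rw [add_zero, Finset.card_insert_of_notMem hi, Nat.cast_succ, add_comm]

lemma armLaw_map_prodMk_sampleMean_sub (hk : 1 ≤ k) (hkm : k ≤ m) :
    (armLaw ν v m).map (fun p => (p.1, sampleMean k p - p.1)) =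
      (gaussianReal ν v).prod (gaussianReal 0 (k : ℝ≥0)⁻¹) := by
  have hk0 : (k : ℝ) ≠ 0 := by positivity
  have hcard : (Finset.univ.filter fun s : Fin m => (s : ℕ) < k).card = k := by
    rw [Fin.card_filter_val_lt, min_eq_right hkm]
  have hnoise : (Measure.pi fun _ : Fin m => gaussianReal 0 1).map
      (fun ξ : Fin m → ℝ => (∑ s : Fin m with s.val < k, ξ s) / k) =
        gaussianReal 0 (k : ℝ≥0)⁻¹ := by
    rw [(gaussianReal_div_const (hasLaw_sum_gaussianReal _) (k : ℝ)).map_eq, hcard, zero_div]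
    congr 1
    apply NNReal.coe_injective
    push_cast
    field_simp
  have hcomp : (fun p : ℝ × (Fin m → ℝ) => (p.1, sampleMean k p - p.1)) ∘
      (fun p => (p.1, fun s => p.1 + p.2 s)) =
      Prod.map id fun ξ : Fin m → ℝ => (∑ s : Fin m with s.val < k, ξ s) / (k : ℝ) := by
    ext p
    · rfl
    · simp only [sampleMean, Function.comp_apply, Prod.map_snd, Finset.sum_add_distrib,
        Finset.sum_const, hcard, nsmul_eq_mul]
      field_simp
      ring
  rw [armLaw, Measure.map_map (by fun_prop) (by fun_prop), hcomp,
    ← Measure.map_prod_map _ _ measurable_id (by fun_prop), Measure.map_id, hnoise]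

lemma armLaw_map_fst (ν : ℝ) (v : ℝ≥0) (m : ℕ) :
    (armLaw ν v m).map Prod.fst = gaussianReal ν v := by
  rw [armLaw, Measure.map_map measurable_fst (by fun_prop)]
  exact (measurePreserving_fst (μ := gaussianReal ν v)
    (ν := Measure.pi fun _ : Fin m => gaussianReal 0 1)).map_eq

lemma integral_armLaw_fst {f : ℝ → ℝ} (hf : Measurable f) :
    ∫ p, f p.1 ∂(armLaw ν v m) = ∫ x, f x ∂(gaussianReal ν v) := by
  rw [← armLaw_map_fst ν v m,
    integral_map measurable_fst.aemeasurable hf.aestronglyMeasurable]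

lemma integrable_armLaw_fst {f : ℝ → ℝ} (hf : Integrable f (gaussianReal ν v)) :
    Integrable (fun p => f p.1) (armLaw ν v m) := by
  rw [← armLaw_map_fst ν v m] at hf
  exact hf.comp_measurable measurable_fst

lemma integrable_sub_gaussianReal (γ : ℝ) : Integrable (fun x => x - γ) (gaussianReal ν v) :=
  (integrable_id_gaussianReal ν v).sub (integrable_const γ)

lemma integral_sub_gaussianReal (γ : ℝ) : ∫ x, (x - γ) ∂(gaussianReal ν v) = ν - γ := by
  rw [integral_sub (integrable_id_gaussianReal ν v) (integrable_const γ),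
    integral_id_gaussianReal, integral_const, probReal_univ, one_smul]

lemma setIntegral_sampleMean_eq_meanExcess (hk : 1 ≤ k) (hkm : k ≤ m) (a : ℝ) :
    ∫ p in {p | a ≤ v / (v + (k : ℝ≥0)⁻¹ : ℝ≥0) * (sampleMean k p - ν)}, (p.1 - (ν + a))
        ∂(armLaw ν v m) = meanExcess (gaussianReal 0 (v ^ 2 / (v + (k : ℝ≥0)⁻¹))) a := by
  have hk0 : (0 : ℝ≥0) < (k : ℝ≥0)⁻¹ := by positivity
  have hNm : Measurable fun p : ℝ × (Fin m → ℝ) => sampleMean k p - p.1 := by fun_prop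
  have hjoint := armLaw_map_prodMk_sampleMean_sub (ν := ν) (v := v) hk hkm
  have hN : (armLaw ν v m).map (fun p => sampleMean k p - p.1) = gaussianReal 0 (k : ℝ≥0)⁻¹ := by
    rw [← Measure.snd_map_prodMk (X := Prod.fst) measurable_fst, hjoint, Measure.snd_prod]
  have hind : IndepFun Prod.fst (fun p => sampleMean k p - p.1) (armLaw ν v m) := by
    rw [indepFun_iff_map_prod_eq_prod_map_map measurable_fst.aemeasurable hNm.aemeasurable,
      armLaw_map_fst, hN, hjoint]
  simpa only [add_sub_cancel, NNReal.coe_add] using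
    setIntegral_posterior_eq_meanExcess (add_pos_of_nonneg_of_pos zero_le hk0).ne' measurable_fst
      hNm ⟨measurable_fst.aemeasurable, armLaw_map_fst ν v m⟩ ⟨hNm.aemeasurable, hN⟩ hind a

end Arm

section Index

variable {ν : ℝ} {v : ℝ≥0} {k m : ℕ} {τ : ℝ × (Fin m → ℝ) → ℕ}

lemma IsAdmissible.measurable (hτ : IsAdmissible m τ) : Measurable τ :=
  measurable_of_Iic fun i => by
    simpa [Set.Iic, Set.preimage] using (rewardFiltration m).le i _ (hτ.isStoppingTime i)

lemma isAdmissible_one (hm : 1 ≤ m) : IsAdmissible m fun _ => 1 :=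
  ⟨isStoppingTime_const _ 1, fun _ => le_rfl, fun _ => hm⟩

lemma isAdmissible_ite (hk : 1 ≤ k) (hkm : k ≤ m) {A : Set (ℝ × (Fin m → ℝ))}
    [DecidablePred (· ∈ A)] (hA : MeasurableSet[rewardFiltration m k] A) :
    IsAdmissible m fun p => if p ∈ A then m else k where
  isStoppingTime := by
    convert (isStoppingTime_const (rewardFiltration m) m).piecewise_of_le
      (isStoppingTime_const _ k) (fun _ => mod_cast hkm) (fun _ => le_rfl) hA using 1
    ext p
    by_cases hp : p ∈ A <;> simp [hp]
  one_le p := by split_ifs <;> lia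
  le p := by split_ifs <;> lia

lemma integrable_mul_isAdmissible (hτ : IsAdmissible m τ) (γ : ℝ) :
    Integrable (fun p => (p.1 - γ) * (τ p : ℝ)) (armLaw ν v m) := by
  refine (integrable_armLaw_fst (integrable_sub_gaussianReal γ)).mul_bdd (c := m) ?_ ?_
  · exact (measurable_from_top.comp hτ.measurable).aestronglyMeasurable
  · exact .of_forall fun p => by simpa using hτ.le p

lemma integral_mul_isAdmissible_le (hτ : IsAdmissible m τ) (γ : ℝ) :
    ∫ p, (p.1 - γ) * (τ p : ℝ) ∂(armLaw ν v m) ≤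
      (ν - γ) + (m - 1) * meanExcess (gaussianReal ν v) γ := by
  have hi := integrable_sub_gaussianReal (ν := ν) (v := v) γ
  have hi' : Integrable (fun x => (m - 1) * max (x - γ) 0) (gaussianReal ν v) :=
    hi.pos_part.const_mul _
  rw [meanExcess, ← integral_sub_gaussianReal (ν := ν) (v := v) γ, ← integral_const_mul,
    ← integral_add hi hi', ← integral_armLaw_fst (m := m) (by fun_prop)]
  refine integral_mono (integrable_mul_isAdmissible hτ γ) (integrable_armLaw_fst (hi.add hi'))
    fun p => ?_
  have h1 : (1 : ℝ) ≤ τ p := by exact_mod_cast hτ.one_le p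
  have hm : (τ p : ℝ) ≤ m := by exact_mod_cast hτ.le p
  dsimp only
  nlinarith [mul_nonneg (sub_nonneg.2 h1) (sub_nonneg.2 (le_max_left (p.1 - γ) 0)),
    mul_nonneg (sub_nonneg.2 hm) (le_max_right (p.1 - γ) 0)]

lemma le_stoppingValue (hτ : IsAdmissible m τ) (γ : ℝ) :
    ∫ p, (p.1 - γ) * (τ p : ℝ) ∂(armLaw ν v m) ≤ stoppingValue ν v m γ := by
  refine le_ciSup (f := fun τ : {τ // IsAdmissible m τ} =>
    ∫ p, (p.1 - γ) * (τ.1 p : ℝ) ∂(armLaw ν v m))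
    ⟨(ν - γ) + (m - 1) * meanExcess (gaussianReal ν v) γ, ?_⟩ ⟨τ, hτ⟩
  rintro _ ⟨τ, rfl⟩
  exact integral_mul_isAdmissible_le τ.2 γ

lemma stoppingValue_le (hm : 1 ≤ m) (γ : ℝ) :
    stoppingValue ν v m γ ≤ (ν - γ) + (m - 1) * meanExcess (gaussianReal ν v) γ := by
  have : Nonempty {τ : ℝ × (Fin m → ℝ) → ℕ // IsAdmissible m τ} := ⟨⟨_, isAdmissible_one hm⟩⟩
  exact ciSup_le fun τ => integral_mul_isAdmissible_le τ.2 γ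

lemma stoppingValue_self_nonneg (hm : 1 ≤ m) : 0 ≤ stoppingValue ν v m ν := by
  refine le_trans (le_of_eq ?_) (le_stoppingValue (isAdmissible_one hm) ν)
  simp only [Nat.cast_one, mul_one]
  rw [integral_armLaw_fst (f := fun x => x - ν) (by fun_prop), integral_sub_gaussianReal, sub_self]

lemma stoppingValue_neg (hv : 0 < v) (hm : 1 ≤ m) {x γ : ℝ} (hx : 1 ≤ x)
    (hmx : (m : ℝ) ≤ Real.exp (x ^ 2 / 2)) (hγ : ν + √v * x < γ) : stoppingValue ν v m γ < 0 := by
  have hs : 0 < √(v : ℝ) := Real.sqrt_pos.2 (by exact_mod_cast hv)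
  have hsq : √(v : ℝ) ^ 2 = v := Real.sq_sqrt v.2
  set s := √(v : ℝ)
  obtain ⟨y, rfl⟩ : ∃ y, γ = ν + s * y := ⟨(γ - ν) / s, by field_simp; ring⟩
  have hxy : x < y := lt_of_mul_lt_mul_left (by linarith) hs.le
  have hy : 1 < y := hx.trans_lt hxy
  have hexcess : meanExcess (gaussianReal ν v) (ν + s * y) ≤ s / y * Real.exp (-(y ^ 2 / 2)) := by
    refine (meanExcess_gaussianReal_le ν v (l := y / s) (by positivity) _).trans_eq ?_
    have hexp : y / s * (ν - (ν + s * y)) + v * (y / s) ^ 2 / 2 = -(y ^ 2 / 2) := by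
      rw [← hsq]
      field_simp
      ring
    rw [hexp]
    field_simp
  have hmy : (m : ℝ) * Real.exp (-(y ^ 2 / 2)) ≤ 1 := by
    rw [Real.exp_neg, ← div_eq_mul_inv, div_le_one (Real.exp_pos _)]
    exact hmx.trans (Real.exp_le_exp.2 (by nlinarith))
  have hm1 : (0 : ℝ) ≤ m - 1 := sub_nonneg.2 (by exact_mod_cast hm)
  calc stoppingValue ν v m (ν + s * y)
      ≤ ν - (ν + s * y) + (m - 1) * (s / y * Real.exp (-(y ^ 2 / 2))) :=
        (stoppingValue_le hm _).trans (by gcongr)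
    _ = s / y * ((m * Real.exp (-(y ^ 2 / 2)) - y ^ 2) - Real.exp (-(y ^ 2 / 2))) := by
        field_simp
        ring
    _ < 0 := mul_neg_of_pos_of_neg (by positivity) (by
        nlinarith [Real.exp_pos (-(y ^ 2 / 2))])

lemma gittinsIndex_le (hv : 0 < v) (hm : 1 ≤ m) {x : ℝ} (hx : 1 ≤ x)
    (hmx : (m : ℝ) ≤ Real.exp (x ^ 2 / 2)) : gittinsIndex ν v m ≤ ν + √v * x :=
  csSup_le ⟨ν, stoppingValue_self_nonneg hm⟩ fun _ hγ => le_of_not_gt fun h =>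
    (stoppingValue_neg hv hm hx hmx h).not_ge hγ

lemma le_gittinsIndex (hv : 0 < v) (hm : 1 ≤ m) {γ : ℝ} (h : 0 ≤ stoppingValue ν v m γ) :
    γ ≤ gittinsIndex ν v m := by
  refine le_csSup ⟨ν + √v * max 1 (m : ℝ), fun γ hγ => le_of_not_gt fun h => ?_⟩ h
  refine (stoppingValue_neg hv hm (le_max_left _ _) ?_ h).not_ge hγ
  nlinarith [le_max_right (1 : ℝ) m, Real.add_one_le_exp (max 1 (m : ℝ) ^ 2 / 2),
    sq_nonneg (max 1 (m : ℝ) - 1)]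

/-- The value of the rule that looks at `k` rewards and then continues to time `m` exactly if the
posterior mean is at least `ν + a`. -/
lemma add_mul_meanExcess_le_stoppingValue (hk : 1 ≤ k) (hkm : k ≤ m) (a : ℝ) :
    -(k * a) + (m - k) * meanExcess (gaussianReal 0 (v ^ 2 / (v + (k : ℝ≥0)⁻¹))) a ≤
      stoppingValue ν v m (ν + a) := by
  classical
  set A : Set (ℝ × (Fin m → ℝ)) :=
    {p | a ≤ v / (v + (k : ℝ≥0)⁻¹ : ℝ≥0) * (sampleMean k p - ν)} with hA_def
  have hA : MeasurableSet[rewardFiltration m k] A :=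
    measurableSet_le measurable_const
      ((measurable_sampleMean_rewardFiltration.sub_const _).const_mul _)
  have hA' : MeasurableSet A := (rewardFiltration m).le k _ hA
  have hi : Integrable (fun p : ℝ × (Fin m → ℝ) => p.1 - (ν + a)) (armLaw ν v m) :=
    integrable_armLaw_fst (integrable_sub_gaussianReal (ν + a))
  refine le_trans (le_of_eq ?_) (le_stoppingValue (isAdmissible_ite hk hkm hA) (ν + a))
  have hmean : ∫ p, (p.1 - (ν + a)) ∂(armLaw ν v m) = -a := by
    rw [integral_armLaw_fst (f := fun x => x - (ν + a)) (by fun_prop), integral_sub_gaussianReal]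
    ring
  rw [← setIntegral_sampleMean_eq_meanExcess (ν := ν) hk hkm, ← hA_def, ← integral_indicator hA',
    ← mul_neg, ← hmean, ← integral_const_mul, ← integral_const_mul,
    ← integral_add (hi.const_mul _) ((hi.indicator hA').const_mul _)]
  congr 1
  ext p
  by_cases hp : p ∈ A
  · simp only [hp, if_true, Set.indicator_of_mem]
    ring
  · simp only [hp, if_false, Set.indicator_of_notMem, not_false_eq_true]
    ring

lemma le_meanExcess_gaussianReal_sqrt_mul {w : ℝ≥0} (hw : 0 < w) (hwv : w ≤ v) {x : ℝ} (hx : 1 ≤ x)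
    (hvw : v * x ^ 2 ≤ w * (x ^ 2 + 1)) :
    √v * Real.exp (-(x ^ 2 / 2) - 9) / (3 * x ^ 2) ≤
      meanExcess (gaussianReal 0 w) (√v * x) := by
  have hv : (0 : ℝ) < v := by exact_mod_cast hw.trans_le hwv
  have hsq : √(v : ℝ) ^ 2 = v := Real.sq_sqrt v.2
  have hnorm : √(2 * Real.pi * w) ≤ 3 * √v := by
    rw [Real.sqrt_le_left (by positivity), mul_pow, hsq]
    nlinarith [Real.pi_lt_four, Real.pi_lt_d2]
  have hexp : (√v * x + 2 * (√v / x) - 0) ^ 2 / (2 * w) ≤ x ^ 2 / 2 + 9 := by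
    have hq : 1 / x ^ 2 ≤ 1 := (div_le_one (by positivity)).2 (one_le_pow₀ hx)
    have hq0 : 0 ≤ 1 / x ^ 2 := by positivity
    calc (√v * x + 2 * (√v / x) - 0) ^ 2 / (2 * w)
        = v * x ^ 2 * (1 + 2 * (1 / x ^ 2)) ^ 2 / (2 * w) := by
          rw [show √(v : ℝ) * x + 2 * (√v / x) - 0 = √v * (x * (1 + 2 * (1 / x ^ 2))) by
            field_simp
            ring, mul_pow, hsq, mul_pow, mul_assoc]
      _ ≤ w * (x ^ 2 + 1) * (1 + 2 * (1 / x ^ 2)) ^ 2 / (2 * w) := by gcongr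
      _ = x ^ 2 / 2 + (5 + 8 * (1 / x ^ 2) + 4 * (1 / x ^ 2) ^ 2) / 2 := by
          field_simp
          ring
      _ ≤ x ^ 2 / 2 + 9 := by nlinarith
  -- The Gaussian tail beyond `√v * x` decays on the scale `√v / x`.
  calc √v * Real.exp (-(x ^ 2 / 2) - 9) / (3 * x ^ 2)
      = (√v / x) ^ 2 * ((3 * √v)⁻¹ * Real.exp (-(x ^ 2 / 2) - 9)) := by field_simp
    _ ≤ (√v / x) ^ 2 * gaussianPDFReal 0 w (√v * x + 2 * (√v / x)) := by
        rw [gaussianPDFReal, neg_div]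
        gcongr
        linarith
    _ ≤ meanExcess (gaussianReal 0 w) (√v * x) :=
        sq_mul_gaussianPDFReal_le_meanExcess hw.ne' (by positivity) (by positivity)

lemma le_meanExcess_posterior (hk : 1 ≤ k) (hv : 0 < v) {x : ℝ} (hx : 1 ≤ x)
    (hkv : x ^ 2 ≤ k * v) :
    √v * Real.exp (-(x ^ 2 / 2) - 9) / (3 * x ^ 2) ≤
      meanExcess (gaussianReal 0 (v ^ 2 / (v + (k : ℝ≥0)⁻¹))) (√v * x) := by
  have hk' : (0 : ℝ) < k := by positivity
  refine le_meanExcess_gaussianReal_sqrt_mul (by positivity) ?_ hx ?_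
  · refine div_le_of_le_mul₀ zero_le zero_le ?_
    rw [sq]
    gcongr
    exact le_self_add
  · push_cast
    rw [div_mul_eq_mul_div, le_div_iff₀ (by positivity)]
    have : (v : ℝ) * x ^ 2 * (k : ℝ)⁻¹ ≤ v * v := by
      rw [mul_inv_le_iff₀ hk']
      nlinarith
    nlinarith

lemma add_sqrt_mul_le_gittinsIndex_of_sq_le (hk : 1 ≤ k) (hkm : k ≤ m) (hv : 0 < v) {x : ℝ}
    (hx : 1 ≤ x) (hkv : x ^ 2 ≤ k * v)
    (hm : k * (3 * x ^ 3 * Real.exp (x ^ 2 / 2 + 9)) ≤ m - k) :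
    ν + √v * x ≤ gittinsIndex ν v m := by
  refine le_gittinsIndex hv (hk.trans hkm)
    (le_trans ?_ (add_mul_meanExcess_le_stoppingValue hk hkm (√v * x)))
  have hmk : (0 : ℝ) ≤ m - k := sub_nonneg.2 (by exact_mod_cast hkm)
  have hgain : k * (√v * x) ≤
      (m - k) * meanExcess (gaussianReal 0 (v ^ 2 / (v + (k : ℝ≥0)⁻¹))) (√v * x) :=
    calc k * (√v * x) = k * (3 * x ^ 3 * Real.exp (x ^ 2 / 2 + 9)) *
          (√v * Real.exp (-(x ^ 2 / 2) - 9) / (3 * x ^ 2)) := by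
          rw [show -(x ^ 2 / 2) - 9 = -(x ^ 2 / 2 + 9) by ring, Real.exp_neg]
          field_simp
      _ ≤ (m - k) * (√v * Real.exp (-(x ^ 2 / 2) - 9) / (3 * x ^ 2)) := by gcongr
      _ ≤ _ := by
          gcongr
          exact le_meanExcess_posterior hk hv hx hkv
  linarith

lemma add_sqrt_mul_le_gittinsIndex (hv : 0 < v) {x : ℝ} (hx : 1 ≤ x)
    (hm : 6 * Real.exp 9 * (1 + 1 / v) * x ^ 5 * Real.exp (x ^ 2 / 2) ≤ m) :
    ν + √v * x ≤ gittinsIndex ν v m := by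
  have hv' : (0 : ℝ) < v := by exact_mod_cast hv
  set k := ⌈x ^ 2 / (v : ℝ)⌉₊
  have hk : 1 ≤ k := Nat.one_le_ceil_iff.2 (by positivity)
  have hkv : x ^ 2 ≤ k * v := (div_le_iff₀ hv').1 (Nat.le_ceil _)
  have hk_le : (k : ℝ) ≤ x ^ 2 * (1 + 1 / v) := by
    have := (Nat.ceil_lt_add_one (show 0 ≤ x ^ 2 / (v : ℝ) by positivity)).le
    rw [mul_add, mul_one, mul_one_div]
    nlinarith
  have hkm : k * (6 * x ^ 3 * Real.exp (x ^ 2 / 2 + 9)) ≤ m :=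
    calc k * (6 * x ^ 3 * Real.exp (x ^ 2 / 2 + 9))
        ≤ x ^ 2 * (1 + 1 / v) * (6 * x ^ 3 * Real.exp (x ^ 2 / 2 + 9)) := by gcongr
      _ = 6 * Real.exp 9 * (1 + 1 / v) * x ^ 5 * Real.exp (x ^ 2 / 2) := by
          rw [Real.exp_add]
          ring
      _ ≤ m := hm
  have hone : 1 * 1 ≤ x ^ 3 * Real.exp (x ^ 2 / 2 + 9) := by
    gcongr
    · exact one_le_pow₀ hx
    · exact Real.one_le_exp (by positivity)
  have hk2 : 2 * (k : ℝ) ≤ m := by nlinarith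
  refine add_sqrt_mul_le_gittinsIndex_of_sq_le hk ?_ hv hx hkv (by linarith)
  have : (k : ℝ) ≤ m := by linarith
  exact_mod_cast this

/-- The constant in the bound on the number of remaining rounds that `le_of_gittinsIndex_lt` yields
when the polynomial factors are absorbed into `exp (η * x)`. -/
noncomputable def horizonConst (η : ℝ) : ℝ := 720 * Real.exp (9 + η + 1 / 2) / η ^ 5

lemma horizonConst_pos {η : ℝ} (hη : 0 < η) : 0 < horizonConst η := by
  unfold horizonConst
  positivity

lemma le_of_gittinsIndex_lt {η x : ℝ} (hη : 0 < η) (hv : 0 < v) (hx : 0 < x)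
    (h : gittinsIndex ν v m < ν + √v * x) :
    (m : ℝ) ≤ horizonConst η * (1 + 1 / v) * Real.exp (x ^ 2 / 2 + η * x) := by
  set z := max 1 x with hz
  have hz1 : 1 ≤ z := le_max_left _ _
  have hzx : z ≤ 1 + x := max_le (by linarith) (by linarith)
  have hz_sq : z ^ 2 ≤ 1 + x ^ 2 := by
    rcases max_cases 1 x with ⟨h, -⟩ | ⟨h, -⟩ <;> rw [hz, h] <;> nlinarith
  have hz_lt : gittinsIndex ν v m < ν + √v * z := h.trans_le (by gcongr; exact le_max_right _ _)
  have hz_pow : z ^ 5 ≤ 120 / η ^ 5 * Real.exp (η * z) := by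
    have := Real.pow_div_factorial_le_exp (x := η * z) (by positivity) 5
    rw [div_mul_eq_mul_div, le_div_iff₀ (by positivity)]
    rw [div_le_iff₀ (by positivity), mul_pow] at this
    norm_num [Nat.factorial] at this
    linarith
  calc (m : ℝ) ≤ 6 * Real.exp 9 * (1 + 1 / v) * z ^ 5 * Real.exp (z ^ 2 / 2) :=
        (not_le.1 fun hm => hz_lt.not_ge (add_sqrt_mul_le_gittinsIndex hv hz1 hm)).le
    _ ≤ 6 * Real.exp 9 * (1 + 1 / v) * (120 / η ^ 5 * Real.exp (η * (1 + x))) *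
        Real.exp ((1 + x ^ 2) / 2) := by
        gcongr
        exact hz_pow.trans (by gcongr)
    _ = horizonConst η * (1 + 1 / v) * Real.exp (x ^ 2 / 2 + η * x) := by
        have hexp : Real.exp (9 + η + 1 / 2) * Real.exp (x ^ 2 / 2 + η * x) =
            Real.exp 9 * Real.exp (η * (1 + x)) * Real.exp ((1 + x ^ 2) / 2) := by
          simp only [← Real.exp_add]
          ring_nf
        rw [horizonConst]
        linear_combination (-720 * (1 + 1 / v) / η ^ 5) * hexp

end Index

section Potential

variable {d : ℕ}

@[fun_prop]
lemma measurable_pulls (t : ℕ) (i : Fin d) : Measurable fun h : History d t => pulls h i :=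
  Finset.measurable_sum _ fun s _ =>
    (measurable_of_countable fun j : Fin d => if j = i then 1 else 0).comp
      (measurable_fst.comp (measurable_pi_apply s))

@[fun_prop]
lemma measurable_rewardSum (t : ℕ) (i : Fin d) : Measurable fun h : History d t => rewardSum h i :=
  Finset.measurable_sum _ fun s _ =>
    Measurable.ite (measurableSet_eq_fun (measurable_fst.comp (measurable_pi_apply s))
      measurable_const) (measurable_snd.comp (measurable_pi_apply s)) measurable_const

lemma measurable_pulls_rewardSum {β : Type*} [MeasurableSpace β] {f : ℕ → ℝ → β}
    (hf : ∀ s, Measurable (f s)) (t : ℕ) (i : Fin d) :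
    Measurable fun h : History d t => f (pulls h i) (rewardSum h i) :=
  (measurable_from_prod_countable_right (f := fun p : ℕ × ℝ => f p.1 p.2) hf).comp
    ((measurable_pulls t i).prodMk (measurable_rewardSum t i))

lemma pulls_snoc {t : ℕ} (h : History d t) (j : Fin d) (x : ℝ) (i : Fin d) :
    pulls (Fin.snoc h (j, x) : History d (t + 1)) i = pulls h i + if j = i then 1 else 0 := by
  simp only [pulls, Fin.sum_univ_castSucc, Fin.snoc_castSucc, Fin.snoc_last]

lemma rewardSum_snoc {t : ℕ} (h : History d t) (j : Fin d) (x : ℝ) (i : Fin d) :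
    rewardSum (Fin.snoc h (j, x) : History d (t + 1)) i =
      rewardSum h i + if j = i then x else 0 := by
  simp only [rewardSum, Fin.sum_univ_castSucc, Fin.snoc_castSucc, Fin.snoc_last]

lemma lintegral_ite_eq (ρ : Measure (Fin d)) (i : Fin d) (a b : ℝ≥0∞) :
    ∫⁻ j, (if j = i then a else b) ∂ρ = a * ρ {i} + b * ρ {i}ᶜ := by
  simpa only [Set.piecewise, Set.mem_singleton_iff, setLIntegral_const] using
    lintegral_piecewise (μ := ρ) (measurableSet_singleton i) (fun _ => a) fun _ => b

lemma lintegral_historyLaw_succ (π : Strategy d) (μ : Fin d → ℝ) (t : ℕ)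
    {F : History d (t + 1) → ℝ≥0∞} (hF : Measurable F) :
    ∫⁻ h, F h ∂(historyLaw π μ (t + 1)) =
      ∫⁻ h, ∫⁻ j, ∫⁻ x, F (Fin.snoc h (j, x)) ∂(gaussianReal (μ j) 1) ∂(π.act t h)
        ∂(historyLaw π μ t) := by
  have hG : Measurable fun p : History d t × (Fin d × ℝ) => F (Fin.snoc p.1 p.2) :=
    hF.comp (measurable_snoc d t)
  rw [historyLaw, lintegral_map hF (measurable_snoc d t), Measure.lintegral_compProd hG]
  exact lintegral_congr fun h => Kernel.lintegral_compProd _ _ _ (hG.comp measurable_prodMk_left)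

lemma sum_lintegral_le_of_potential (π : Strategy d) (μ : Fin d → ℝ) {n : ℕ}
    {Φ c : (t : ℕ) → History d t → ℝ≥0∞} (hΦ : ∀ t, Measurable (Φ t))
    (hstep : ∀ t < n, ∀ h, c t h + ∫⁻ j, ∫⁻ x, Φ (t + 1) (Fin.snoc h (j, x))
      ∂(gaussianReal (μ j) 1) ∂(π.act t h) ≤ Φ t h) :
    ∑ t ∈ Finset.range n, ∫⁻ h, c t h ∂(historyLaw π μ t) ≤ Φ 0 Fin.elim0 := by
  suffices hk : ∀ k ≤ n, ∑ t ∈ Finset.range k, ∫⁻ h, c t h ∂(historyLaw π μ t) +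
      ∫⁻ h, Φ k h ∂(historyLaw π μ k) ≤ Φ 0 Fin.elim0 from le_self_add.trans (hk n le_rfl)
  intro k
  induction k with
  | zero =>
    intro _
    rw [historyLaw, lintegral_dirac' _ (hΦ 0), Finset.range_zero, Finset.sum_empty, zero_add]
  | succ k ih =>
    intro hk
    rw [Finset.sum_range_succ, add_assoc, lintegral_historyLaw_succ π μ k (hΦ (k + 1))]
    refine (add_le_add_right ((le_lintegral_add _ _).trans ?_) _).trans (ih (by lia))
    exact lintegral_mono fun h => hstep k (by lia) h

/-- The potential of a history with `T` pulls of an arm with mean `m` and sum of rewards `S`: the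
expectation of `g` at the sum of the first `s` rewards, and zero if there are already more.
Averaging over the next pull of the arm preserves it as long as `T < s`. -/
noncomputable def levelPotential (m : ℝ) (s : ℕ) (g : ℝ → ℝ≥0∞) (T : ℕ) (S : ℝ) : ℝ≥0∞ :=
  if T ≤ s then ∫⁻ y, g (S + y) ∂(gaussianReal ((s - T : ℕ) * m) (s - T : ℕ)) else 0

lemma measurable_levelPotential (m : ℝ) (s : ℕ) {g : ℝ → ℝ≥0∞} (hg : Measurable g) (T : ℕ) :
    Measurable (levelPotential m s g T) := by
  unfold levelPotential
  split_ifs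
  · exact Measurable.lintegral_prod_right' (f := fun p : ℝ × ℝ => g (p.1 + p.2)) (by fun_prop)
  · exact measurable_const

lemma levelPotential_self (m : ℝ) (s : ℕ) (g : ℝ → ℝ≥0∞) (S : ℝ) :
    levelPotential m s g s S = g S := by
  simp [levelPotential, gaussianReal_zero_var]

lemma levelPotential_of_lt (m : ℝ) {s T : ℕ} (g : ℝ → ℝ≥0∞) (S : ℝ) (h : s < T) :
    levelPotential m s g T S = 0 :=
  if_neg (not_le.2 h)

lemma levelPotential_mono (m : ℝ) (s : ℕ) {g g' : ℝ → ℝ≥0∞} (h : ∀ y, g y ≤ g' y) (T : ℕ) (S : ℝ) :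
    levelPotential m s g T S ≤ levelPotential m s g' T S := by
  unfold levelPotential
  split_ifs
  · exact lintegral_mono fun y => h _
  · exact le_rfl

lemma lintegral_levelPotential_succ (m : ℝ) {s T : ℕ} {g : ℝ → ℝ≥0∞} (hg : Measurable g) (S : ℝ)
    (h : T < s) :
    ∫⁻ x, levelPotential m s g (T + 1) (S + x) ∂(gaussianReal m 1) = levelPotential m s g T S := by
  obtain ⟨r, rfl⟩ := Nat.exists_eq_add_of_lt h
  have hconv := Measure.lintegral_conv (μ := gaussianReal m 1) (ν := gaussianReal (r * m) r)
    (hg.comp (measurable_const_add S))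
  rw [gaussianReal_conv_gaussianReal] at hconv
  simp only [levelPotential, if_pos h.le, if_pos (Nat.succ_le_of_lt h),
    show T + r + 1 - (T + 1) = r by lia, show T + r + 1 - T = r + 1 by lia]
  simp only [Function.comp_apply, ← add_assoc] at hconv
  rw [← hconv]
  congr 2
  · push_cast; ring
  · push_cast; ring

variable (π : Strategy d) (μ : Fin d → ℝ)

lemma sum_setLIntegral_pulls_eq_le (i : Fin d) (s n : ℕ) {g : ℕ → ℝ → ℝ≥0∞}
    (hg : ∀ t, Measurable (g t)) (hanti : Antitone g) {c : (t : ℕ) → History d t → ℝ≥0∞}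
    (hc : ∀ t < n, ∀ h : History d t, pulls h i = s →
      c t h + g (t + 1) (rewardSum h i) * π.act t h {i}ᶜ ≤ g t (rewardSum h i)) :
    ∑ t ∈ Finset.range n, ∫⁻ h in {h | pulls h i = s}, c t h ∂(historyLaw π μ t) ≤
      ∫⁻ y, g 0 y ∂(gaussianReal (s * μ i) s) := by
  set Φ : (t : ℕ) → History d t → ℝ≥0∞ := fun t h =>
    levelPotential (μ i) s (g t) (pulls h i) (rewardSum h i) with hΦ
  have hΦ_meas : ∀ t, Measurable (Φ t) := fun t =>
    measurable_pulls_rewardSum (fun T => measurable_levelPotential _ s (hg t) T) t i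
  have hlevel : ∀ t, MeasurableSet {h : History d t | pulls h i = s} := fun t =>
    measurableSet_eq_fun (measurable_pulls t i) measurable_const
  have hΦ₀ : Φ 0 Fin.elim0 = ∫⁻ y, g 0 y ∂(gaussianReal (s * μ i) s) := by
    simp [hΦ, levelPotential, pulls, rewardSum]
  simp only [← lintegral_indicator (hlevel _), ← hΦ₀]
  refine sum_lintegral_le_of_potential π μ hΦ_meas fun t ht h => ?_
  have hnext : ∀ j, ∫⁻ x, Φ (t + 1) (Fin.snoc h (j, x)) ∂(gaussianReal (μ j) 1) =
      if j = i then ∫⁻ x, levelPotential (μ i) s (g (t + 1)) (pulls h i + 1) (rewardSum h i + x)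
        ∂(gaussianReal (μ i) 1)
      else levelPotential (μ i) s (g (t + 1)) (pulls h i) (rewardSum h i) := by
    intro j
    by_cases hj : j = i <;> simp [hΦ, pulls_snoc, rewardSum_snoc, hj]
  simp only [hnext, lintegral_ite_eq]
  rcases lt_trichotomy (pulls h i) s with hlt | heq | hgt
  · rw [Set.indicator_of_notMem (by exact hlt.ne), zero_add,
      lintegral_levelPotential_succ _ (hg _) _ hlt, ← mul_add,
      prob_add_prob_compl (measurableSet_singleton i), mul_one]
    exact levelPotential_mono _ _ (hanti t.le_succ) _ _
  · rw [Set.indicator_of_mem (by exact heq)]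
    simpa [hΦ, heq, levelPotential_self, levelPotential_of_lt] using hc t ht h heq
  · rw [Set.indicator_of_notMem (by exact hgt.ne')]
    simp [levelPotential_of_lt, hgt, hgt.trans (Nat.lt_succ_self _)]

lemma sum_lintegral_le_tsum_lintegral_gaussianReal (i : Fin d) (n : ℕ) {g : ℕ → ℕ → ℝ → ℝ≥0∞}
    (hg : ∀ s t, Measurable (g s t)) (hanti : ∀ s, Antitone (g s))
    {c : (t : ℕ) → History d t → ℝ≥0∞}
    (hc : ∀ t < n, ∀ h : History d t, c t h +
      g (pulls h i) (t + 1) (rewardSum h i) * π.act t h {i}ᶜ ≤ g (pulls h i) t (rewardSum h i)) :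
    ∑ t ∈ Finset.range n, ∫⁻ h, c t h ∂(historyLaw π μ t) ≤
      ∑' s : ℕ, ∫⁻ y, g s 0 y ∂(gaussianReal (s * μ i) s) := by
  have hsplit : ∀ t, ∫⁻ h, c t h ∂(historyLaw π μ t) =
      ∑' s : ℕ, ∫⁻ h in {h | pulls h i = s}, c t h ∂(historyLaw π μ t) := by
    intro t
    rw [← lintegral_iUnion (fun s => measurableSet_eq_fun (measurable_pulls t i) measurable_const)
      fun s s' hne => Set.disjoint_left.2 fun h hs hs' => hne (hs.symm.trans hs'),
      Set.iUnion_eq_univ_iff.2 fun h => ⟨pulls h i, rfl⟩, setLIntegral_univ]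
  simp only [hsplit]
  rw [← Summable.tsum_finsetSum fun _ _ => ENNReal.summable]
  refine ENNReal.tsum_le_tsum fun s => sum_setLIntegral_pulls_eq_le π μ i s n (hg s) (hanti s) ?_
  rintro t ht h rfl
  exact hc t ht h

lemma sum_setLIntegral_act_le (i : Fin d) (n : ℕ) {B : ℕ → Set ℝ} (hB : ∀ s, MeasurableSet (B s)) :
    ∑ t ∈ Finset.range n,
        ∫⁻ h in {h | rewardSum h i ∈ B (pulls h i)}, π.act t h {i} ∂(historyLaw π μ t) ≤
      ∑' s : ℕ, gaussianReal (s * μ i) s (B s) := by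
  have hG : ∀ t, MeasurableSet {h : History d t | rewardSum h i ∈ B (pulls h i)} := fun t =>
    measurableSet_setOfPred.2 (measurable_pulls_rewardSum (f := fun s y => y ∈ B s)
      (fun s => measurableSet_setOfPred.1 (hB s)) t i)
  simp only [← lintegral_indicator (hG _), ← lintegral_indicator_one (hB _)]
  refine sum_lintegral_le_tsum_lintegral_gaussianReal π μ i n
    (g := fun s _ => (B s).indicator 1) (fun s _ => measurable_one.indicator (hB s))
    (fun _ => antitone_const) fun t _ h => ?_
  by_cases hh : rewardSum h i ∈ B (pulls h i)
  · simp [hh, prob_add_prob_compl (measurableSet_singleton i)]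
  · simp [hh]

/-- At the first round with `pulls h i = s` that belongs to the event, at most `M s y` rounds
remain, so at most `M s y` of these rounds can belong to it, whatever the strategy does. -/
lemma sum_historyLaw_remaining_le (i : Fin d) (n : ℕ) {M : ℕ → ℝ → ℝ≥0∞}
    (hM : ∀ s, Measurable (M s)) :
    ∑ t ∈ Finset.range n,
        historyLaw π μ t {h | ((n - t : ℕ) : ℝ≥0∞) ≤ M (pulls h i) (rewardSum h i)} ≤
      ∑' s : ℕ, ∫⁻ y, M s y ∂(gaussianReal (s * μ i) s) := by
  have hE : ∀ t, MeasurableSet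
      {h : History d t | ((n - t : ℕ) : ℝ≥0∞) ≤ M (pulls h i) (rewardSum h i)} := fun t =>
    measurableSet_le measurable_const (measurable_pulls_rewardSum hM t i)
  simp only [← lintegral_indicator_one (hE _)]
  refine (sum_lintegral_le_tsum_lintegral_gaussianReal π μ i n
    (g := fun s t y => min (M s y) (n - t : ℕ)) (fun s _ => (hM s).min measurable_const)
    (fun s t t' htt' y => min_le_min_left _ (by gcongr)) fun t ht h => ?_).trans
    (ENNReal.tsum_le_tsum fun s => lintegral_mono fun y => min_le_left _ _)
  refine (add_le_add_right (mul_le_of_le_one_right' prob_le_one) _).trans ?_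
  have hsucc : ((n - t : ℕ) : ℝ≥0∞) = 1 + (n - (t + 1) : ℕ) := by
    rw [show n - t = 1 + (n - (t + 1)) by lia, Nat.cast_add, Nat.cast_one]
  by_cases hh : ((n - t : ℕ) : ℝ≥0∞) ≤ M (pulls h i) (rewardSum h i)
  · rw [Set.indicator_of_mem (by exact hh), Pi.one_apply, min_eq_right hh, hsucc]
    gcongr
    exact min_le_right _ _
  · rw [Set.indicator_of_notMem (by exact hh), zero_add, hsucc]
    exact min_le_min_left _ le_add_self

end Potential

section Failure

lemma gaussianReal_tail_le (m : ℝ) (v : ℝ≥0) {a : ℝ} (ha : 0 ≤ a) :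
    gaussianReal m v {y | v * a ≤ y - m} ≤ ENNReal.ofReal (Real.exp (-(v * a ^ 2 / 2))) := by
  have hchernoff := measure_ge_le_exp_mul_mgf (μ := gaussianReal m v) (X := id) (m + v * a) ha
    (integrable_exp_mul_gaussianReal a)
  rw [mgf_id_gaussianReal, ← Real.exp_add] at hchernoff
  simp only [le_sub_iff_add_le']
  rw [← ofReal_measureReal]
  refine ENNReal.ofReal_le_ofReal (hchernoff.trans_eq ?_)
  ring_nf

/-- The distance by which the posterior mean falls short of the level `z`, in units of the posterior
standard deviation, after `s` rewards with sum `y`, for a prior with mean `ν` and precision `w`. -/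
noncomputable def shortfall (ν w z : ℝ) (s : ℕ) (y : ℝ) : ℝ := ((w + s) * z - w * ν - y) / √(w + s)

/-- A bound for the number of rounds that remain when the index is less than the level `z`, after
`s` rewards with sum `y`, for a prior with mean `ν` and precision `w`. -/
noncomputable def failureBound (η ν w z : ℝ) (s : ℕ) (y : ℝ) : ℝ≥0∞ :=
  if 0 < shortfall ν w z s y then
    ENNReal.ofReal (horizonConst η * (1 + (w + s)) *
      Real.exp (shortfall ν w z s y ^ 2 / 2 + η * shortfall ν w z s y))
  else 0

@[fun_prop]
lemma measurable_shortfall (ν w z : ℝ) (s : ℕ) : Measurable (shortfall ν w z s) := by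
  unfold shortfall
  fun_prop

lemma measurable_failureBound (η ν w z : ℝ) (s : ℕ) : Measurable (failureBound η ν w z s) := by
  unfold failureBound
  exact Measurable.ite (measurableSet_lt measurable_const (by fun_prop)) (by fun_prop)
    measurable_const

variable {ε w : ℝ} {s : ℕ}

lemma shortfall_sq_le (hw : 0 < w) (hs : 0 < s) (ν z y : ℝ) :
    shortfall ν w z s y ^ 2 ≤ (s * z - y) ^ 2 / s + w * (z - ν) ^ 2 := by
  have hp : 0 < w + s := by positivity
  have hdefect : (s * z - y) ^ 2 / s + w * (z - ν) ^ 2 - ((w + s) * z - w * ν - y) ^ 2 / (w + s) =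
      w * (s * (z - ν) - (s * z - y)) ^ 2 / (s * (w + s)) := by
    field_simp
    ring
  rw [shortfall, div_pow, Real.sq_sqrt hp.le, ← sub_nonneg, hdefect]
  positivity

lemma gaussianPDFReal_mul_exp_shortfall_le (hε : 0 < ε) (hw : 0 < w) (hs : 0 < s) {ν m y : ℝ}
    (hy : 0 < shortfall ν w (m - ε) s y) :
    gaussianPDFReal (s * m) s y *
        Real.exp (shortfall ν w (m - ε) s y ^ 2 / 2 + ε / 2 * shortfall ν w (m - ε) s y) ≤
      Real.exp (w * (m - ε - ν) ^ 2 / 2 + ε * w * (m - ε - ν) - s * (ε ^ 2 / 2) -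
        ε / 2 * ((w + s) * (m - ε) - w * ν - y)) := by
  have hs1 : (1 : ℝ) ≤ s := by exact_mod_cast hs
  have hpdf : gaussianPDFReal (s * m) s y ≤ Real.exp (-(y - s * m) ^ 2 / (2 * s)) := by
    rw [gaussianPDFReal, NNReal.coe_natCast]
    refine mul_le_of_le_one_left (Real.exp_pos _).le (inv_le_one_of_one_le₀ ?_)
    rw [Real.one_le_sqrt]
    nlinarith [Real.pi_gt_three]
  have hexp : -(y - s * m) ^ 2 / (2 * s) =
      -((s * (m - ε) - y) ^ 2 / s / 2 + ε * (s * (m - ε) - y) + s * (ε ^ 2 / 2)) := by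
    field_simp
    ring
  have hle : shortfall ν w (m - ε) s y ≤ (w + s) * (m - ε) - w * ν - y := by
    have hroot : 0 < √(w + s) := by positivity
    have hroot1 : 1 ≤ √(w + s) := Real.one_le_sqrt.2 (by linarith)
    exact div_le_self ((div_pos_iff_of_pos_right hroot).1 hy).le hroot1
  refine (mul_le_mul_of_nonneg_right hpdf (Real.exp_pos _).le).trans ?_
  rw [← Real.exp_add, hexp]
  refine Real.exp_le_exp.2 ?_
  linarith [shortfall_sq_le hw hs ν (m - ε) y, mul_le_mul_of_nonneg_left hle (half_pos hε).le]

lemma lintegral_failureBound_le (hε : 0 < ε) (hw : 0 < w) (hs : 0 < s) (ν m : ℝ) :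
    ∫⁻ y, failureBound (ε / 2) ν w (m - ε) s y ∂(gaussianReal (s * m) s) ≤
      ENNReal.ofReal (horizonConst (ε / 2) * (1 + (w + s)) * (Real.exp (w * (m - ε - ν) ^ 2 / 2 +
        ε * w * (m - ε - ν) - s * (ε ^ 2 / 2)) * (2 / ε))) := by
  have hK := horizonConst_pos (half_pos hε)
  set A := w * (m - ε - ν) ^ 2 / 2 + ε * w * (m - ε - ν) - s * (ε ^ 2 / 2) with hA
  set b := (w + s) * (m - ε) - w * ν with hb
  set f : ℝ → ℝ := fun y => horizonConst (ε / 2) * (1 + (w + s)) *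
    (Real.exp (A - ε / 2 * b) * Real.exp (ε / 2 * y))
  have hf_int : IntegrableOn f (Set.Iic b) :=
    ((integrableOn_exp_mul_Iic (half_pos hε) b).const_mul _).const_mul _
  have hpoint : ∀ y, gaussianPDF (s * m) s y * failureBound (ε / 2) ν w (m - ε) s y ≤
      (Set.Iic b).indicator (fun y => ENNReal.ofReal (f y)) y := by
    intro y
    unfold failureBound
    split_ifs with hy
    · have hyb : y ≤ b := by
        rw [shortfall, div_pos_iff_of_pos_right (by positivity)] at hy
        linarith
      rw [Set.indicator_of_mem (by exact hyb), gaussianPDF,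
        ← ENNReal.ofReal_mul (gaussianPDFReal_nonneg _ _ _), mul_left_comm]
      refine ENNReal.ofReal_le_ofReal (mul_le_mul_of_nonneg_left ?_ (by positivity))
      refine (gaussianPDFReal_mul_exp_shortfall_le hε hw hs hy).trans_eq ?_
      rw [← Real.exp_add, ← hA, ← hb]
      ring_nf
    · simp
  rw [gaussianReal_of_var_ne_zero _ (by positivity), lintegral_withDensity_eq_lintegral_mul _
    (measurable_gaussianPDF _ _) (measurable_failureBound _ _ _ _ _)]
  refine (lintegral_mono hpoint).trans_eq ?_
  rw [lintegral_indicator measurableSet_Iic, ← ofReal_integral_eq_lintegral_ofReal hf_int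
    (.of_forall fun y => by positivity), integral_const_mul, integral_const_mul,
    integral_exp_mul_Iic (half_pos hε), mul_div_assoc', ← Real.exp_add, sub_add_cancel,
    div_div_eq_mul_div, mul_div_assoc]

lemma tsum_lintegral_failureBound_ne_top (hε : 0 < ε) (hw : 0 < w) (ν m : ℝ) :
    ∑' s : ℕ, ∫⁻ y, failureBound (ε / 2) ν w (m - ε) s y ∂(gaussianReal (s * m) s) ≠ ⊤ := by
  set A := w * (m - ε - ν) ^ 2 / 2 + ε * w * (m - ε - ν)
  have hsum : Summable fun s : ℕ => horizonConst (ε / 2) * (1 + (w + s)) *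
      (Real.exp (A - s * (ε ^ 2 / 2)) * (2 / ε)) := by
    have hq : ‖Real.exp (-(ε ^ 2 / 2))‖ < 1 := by
      rw [Real.norm_eq_abs, Real.abs_exp, Real.exp_lt_one_iff, neg_lt_zero]
      positivity
    have h0 := (summable_pow_mul_geometric_of_norm_lt_one 0 hq).mul_left (1 + w)
    have h1 := summable_pow_mul_geometric_of_norm_lt_one 1 hq
    refine ((h0.add h1).mul_left (horizonConst (ε / 2) * Real.exp A * (2 / ε))).congr fun s => ?_
    have hgeom : Real.exp (A - s * (ε ^ 2 / 2)) = Real.exp A * Real.exp (-(ε ^ 2 / 2)) ^ s := by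
      rw [← Real.exp_nat_mul, ← Real.exp_add, mul_neg, sub_eq_add_neg]
    rw [hgeom]
    ring
  rw [tsum_eq_zero_add' ENNReal.summable]
  refine ENNReal.add_ne_top.2 ⟨?_, ?_⟩
  · simp only [Nat.cast_zero, gaussianReal_zero_var, lintegral_dirac]
    unfold failureBound
    split_ifs <;> simp
  · exact ne_top_of_le_ne_top ((summable_nat_add_iff 1).2 hsum).tsum_ofReal_ne_top
      (ENNReal.tsum_le_tsum fun s => lintegral_failureBound_le hε hw s.succ_pos ν m)

end Failure

lemma limsup_div_le_of_eventually_le {α : Type*} {l : Filter α} {f g : α → ℝ} {A C : ℝ}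
    (hg : Tendsto g l atTop) (hf : ∀ᶠ x in l, f x ≤ A * g x + C) :
    limsup (fun x => ((f x / g x : ℝ) : EReal)) l ≤ A := by
  rcases l.eq_or_neBot with rfl | _
  · simp
  have hlim : Tendsto (fun x => ((A + C / g x : ℝ) : EReal)) l (nhds (A : EReal)) := by
    refine (continuous_coe_real_ereal.tendsto _).comp ?_
    simpa using (hg.const_div_atTop C).const_add A
  refine (limsup_le_limsup ?_).trans_eq hlim.limsup_eq
  filter_upwards [hf, hg.eventually_gt_atTop 0] with x hx hgx
  rw [EReal.coe_le_coe_iff, div_le_iff₀ hgx, add_mul, div_mul_cancel₀ _ hgx.ne']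
  exact hx

lemma lintegral_le_setLIntegral_add_measure {α : Type*} [MeasurableSpace α] {P : Measure α}
    {f : α → ℝ≥0∞} {s t : Set α} (hf : ∀ x, f x ≤ 1)
    (hst : ∀ x, f x ≠ 0 → x ∈ s ∨ x ∈ t) :
    ∫⁻ x, f x ∂P ≤ ∫⁻ x in s, f x ∂P + P t := by
  calc ∫⁻ x, f x ∂P = ∫⁻ x in s ∪ t, f x ∂P := (setLIntegral_eq_of_support_subset hst).symm
    _ ≤ ∫⁻ x in s, f x ∂P + ∫⁻ x in t, f x ∂P := lintegral_union_le f s t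
    _ ≤ ∫⁻ x in s, f x ∂P + P t := by
        gcongr
        exact (lintegral_mono hf).trans_eq (by simp)

section Regret

variable {d t n : ℕ} {i : Fin d}

lemma pulls_le (h : History d t) (i : Fin d) : pulls h i ≤ t := by
  calc pulls h i ≤ ∑ _s : Fin t, 1 := Finset.sum_le_sum fun s _ => by split_ifs <;> simp
    _ = t := by simp

lemma lintegral_pulls (π : Strategy d) (μ : Fin d → ℝ) (i : Fin d) (n : ℕ) :
    ∫⁻ h, (pulls h i : ℝ≥0∞) ∂(historyLaw π μ n) =
      ∑ t ∈ Finset.range n, ∫⁻ h, π.act t h {i} ∂(historyLaw π μ t) := by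
  have hm : ∀ t, Measurable fun h : History d t => (pulls h i : ℝ≥0∞) := fun t =>
    measurable_from_top.comp (measurable_pulls t i)
  induction n with
  | zero => simp [historyLaw, pulls]
  | succ n ih =>
    rw [Finset.sum_range_succ, ← ih, lintegral_historyLaw_succ π μ n (hm (n + 1)),
      ← lintegral_add_left (hm n)]
    refine lintegral_congr fun h => ?_
    simp only [pulls_snoc, lintegral_const, measure_univ, mul_one, Nat.cast_add]
    rw [lintegral_add_left measurable_const]
    simp only [lintegral_const, measure_univ, mul_one, Nat.cast_ite, Nat.cast_one, Nat.cast_zero,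
      lintegral_ite_eq, one_mul, zero_mul, add_zero]

lemma regret_eq (π : Strategy d) (μ : Fin d → ℝ) (n : ℕ) :
    regret π μ n =
      ∑ i, gap μ i * (∫⁻ h, (pulls h i : ℝ≥0∞) ∂(historyLaw π μ n)).toReal := by
  have hm : ∀ i, Measurable fun h : History d n => (pulls h i : ℝ) := fun i =>
    measurable_from_top.comp (measurable_pulls n i)
  have hint : ∀ i, Integrable (fun h : History d n => (pulls h i : ℝ)) (historyLaw π μ n) :=
    fun i => (integrable_const (n : ℝ)).mono' (hm i).aestronglyMeasurable
      (.of_forall fun h => by simpa using pulls_le h i)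
  have hreg : ∀ h : History d n, ∑ t, gap μ (h t).1 = ∑ i, gap μ i * (pulls h i : ℝ) := by
    intro h
    simp only [pulls, Nat.cast_sum, Finset.mul_sum]
    rw [Finset.sum_comm]
    simp
  simp only [regret, hreg]
  rw [integral_finsetSum _ fun i _ => (hint i).const_mul _]
  refine Finset.sum_congr rfl fun i _ => ?_
  rw [integral_const_mul, integral_eq_lintegral_of_nonneg_ae (.of_forall fun h => by positivity)
    (hm i).aestronglyMeasurable]
  simp only [ENNReal.ofReal_natCast]

lemma gap_nonneg (μ : Fin d → ℝ) (i : Fin d) : 0 ≤ gap μ i :=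
  sub_nonneg.2 (le_ciSup (Set.finite_range μ).bddAbove i)

lemma posteriorMean_eq (ν : Fin d → ℝ) (v : Fin d → ℝ≥0) (h : History d t) (i : Fin d) :
    posteriorMean ν v h i =
      ((v i : ℝ)⁻¹ * ν i + rewardSum h i) / ((v i : ℝ)⁻¹ + pulls h i) := by
  rw [posteriorMean, one_div, div_eq_inv_mul (ν i)]

lemma coe_posteriorVar (v : Fin d → ℝ≥0) (h : History d t) (i : Fin d) :
    (posteriorVar v h i : ℝ) = ((v i : ℝ)⁻¹ + pulls h i)⁻¹ := by
  rw [posteriorVar, one_div]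
  push_cast
  rfl

variable {ν : Fin d → ℝ} {v : Fin d → ℝ≥0}

lemma posteriorVar_pos (hv : 0 < v i) (h : History d t) : 0 < posteriorVar v h i := by
  rw [posteriorVar]
  positivity

lemma armIndex_le (hv : 0 < v i) (hn : 2 ≤ n) (ht : t < n) (h : History d t) :
    armIndex ν v n h i ≤ posteriorMean ν v h i + √(posteriorVar v h i * (2 * Real.log n)) := by
  have hn' : (2 : ℝ) ≤ n := by exact_mod_cast hn
  have hlog : 1 / 2 ≤ Real.log n := by
    linarith [Real.log_le_log two_pos hn', Real.log_two_gt_d9]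
  have hexp : ((n - t : ℕ) : ℝ) ≤ Real.exp (√(2 * Real.log n) ^ 2 / 2) := by
    rw [Real.sq_sqrt (by linarith), mul_div_cancel_left₀ _ two_ne_zero, Real.exp_log (by linarith)]
    exact_mod_cast Nat.sub_le n t
  rw [Real.sqrt_mul NNReal.zero_le_coe]
  exact gittinsIndex_le (posteriorVar_pos hv h) (by lia) (Real.one_le_sqrt.2 (by linarith)) hexp

lemma posteriorMean_le_armIndex (hv : 0 < v i) (ht : t < n) (h : History d t) :
    posteriorMean ν v h i ≤ armIndex ν v n h i :=
  le_gittinsIndex (posteriorVar_pos hv h) (by lia) (stoppingValue_self_nonneg (by lia))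

lemma mul_le_rewardSum_sub_of_le_armIndex (hv : 0 < v i) (hn : 2 ≤ n) (ht : t < n) (h : History d t)
    {m D : ℝ} (hD : 0 < D)
    (hs : 32 * Real.log n / D ^ 2 + 8 * ((v i : ℝ)⁻¹ * |m - ν i|) / D ≤ pulls h i)
    (hidx : m + D / 2 ≤ armIndex ν v n h i) :
    pulls h i * (D / 8) ≤ rewardSum h i - pulls h i * m := by
  have hw : 0 < (v i : ℝ)⁻¹ := by positivity
  have hp : 0 < (v i : ℝ)⁻¹ + pulls h i := by positivity
  have hs_log : 32 * Real.log n / D ^ 2 ≤ pulls h i :=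
    (le_add_of_nonneg_right (by positivity)).trans hs
  have hs_prior : 8 * ((v i : ℝ)⁻¹ * |m - ν i|) / D ≤ pulls h i :=
    (le_add_of_nonneg_left (by positivity)).trans hs
  rw [div_le_iff₀ (by positivity)] at hs_log hs_prior
  have hwidth : √(posteriorVar v h i * (2 * Real.log n)) ≤ D / 4 := by
    refine Real.sqrt_le_iff.2 ⟨by positivity, ?_⟩
    rw [coe_posteriorVar, inv_mul_le_iff₀ hp]
    nlinarith [sq_nonneg D]
  have hmean : m + D / 4 ≤ posteriorMean ν v h i := by
    linarith [armIndex_le (ν := ν) hv hn ht h]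
  rw [posteriorMean_eq, le_div_iff₀ hp] at hmean
  have hprior : -((v i : ℝ)⁻¹ * |m - ν i|) ≤ (v i : ℝ)⁻¹ * (m - ν i) := by
    rw [← mul_neg]
    exact mul_le_mul_of_nonneg_left (neg_abs_le _) hw.le
  linarith [mul_pos hw hD]

lemma posteriorMean_add_sqrt_mul_shortfall (hv : 0 < v i) (h : History d t) (z : ℝ) :
    posteriorMean ν v h i + √(posteriorVar v h i : ℝ) *
      shortfall (ν i) (v i : ℝ)⁻¹ z (pulls h i) (rewardSum h i) = z := by
  have hp : 0 < (v i : ℝ)⁻¹ + pulls h i := by positivity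
  rw [shortfall, posteriorMean_eq, coe_posteriorVar, Real.sqrt_inv,
    inv_mul_eq_div (√((v i : ℝ)⁻¹ + pulls h i)), div_div, Real.mul_self_sqrt hp.le, ← add_div,
    div_eq_iff hp.ne']
  ring

lemma le_failureBound_of_armIndex_lt (hv : 0 < v i) (ht : t < n) (h : History d t) {η z : ℝ}
    (hη : 0 < η) (hz : armIndex ν v n h i < z) :
    ((n - t : ℕ) : ℝ≥0∞) ≤ failureBound η (ν i) (v i : ℝ)⁻¹ z (pulls h i) (rewardSum h i) := by
  have hvar := posteriorVar_pos hv h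
  have hz_eq := posteriorMean_add_sqrt_mul_shortfall (ν := ν) hv h z
  have hpos : 0 < shortfall (ν i) (v i : ℝ)⁻¹ z (pulls h i) (rewardSum h i) := by
    have hmean := (posteriorMean_le_armIndex (ν := ν) hv ht h).trans_lt hz
    exact pos_of_mul_pos_right (by linarith) (Real.sqrt_nonneg (posteriorVar v h i : ℝ))
  have hbound := le_of_gittinsIndex_lt hη hvar hpos (hz.trans_eq hz_eq.symm)
  rw [coe_posteriorVar, one_div, inv_inv] at hbound
  rw [failureBound, if_pos hpos, ← ENNReal.ofReal_natCast]
  exact ENNReal.ofReal_le_ofReal hbound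

lemma IsGittinsStrategy.armIndex_le_of_act_ne_zero {π : Strategy d} (hπ : IsGittinsStrategy ν v n π)
    (ht : t < n) {h : History d t} (hi : π.act t h {i} ≠ 0) (j : Fin d) :
    armIndex ν v n h j ≤ armIndex ν v n h i := by
  by_contra hj
  refine hi (measure_mono_null ?_ (ae_iff.1 (hπ t ht h)))
  rintro _ rfl
  exact fun hmax => hj (hmax j)

lemma IsGittinsStrategy.le_rewardSum_or_le_failureBound {π : Strategy d}
    (hπ : IsGittinsStrategy ν v n π) (hn : 2 ≤ n) (ht : t < n) {h : History d t} {k : Fin d}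
    (hvi : 0 < v i) (hvk : 0 < v k) (hi : π.act t h {i} ≠ 0) {m D η : ℝ} (hD : 0 < D) (hη : 0 < η) :
    (32 * Real.log n / D ^ 2 + 8 * ((v i : ℝ)⁻¹ * |m - ν i|) / D ≤ pulls h i →
      pulls h i * (D / 8) ≤ rewardSum h i - pulls h i * m) ∨
    ((n - t : ℕ) : ℝ≥0∞) ≤
      failureBound η (ν k) (v k : ℝ)⁻¹ (m + D / 2) (pulls h k) (rewardSum h k) := by
  rcases lt_or_ge (armIndex ν v n h k) (m + D / 2) with hlt | hge
  · exact .inr (le_failureBound_of_armIndex_lt hvk ht h hη hlt)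
  · exact .inl fun hs => mul_le_rewardSum_sub_of_le_armIndex hvi hn ht h hD hs
      (hge.trans (hπ.armIndex_le_of_act_ne_zero ht hi k))

lemma lintegral_pulls_le_tsum_add_tsum {π : Strategy d} (hπ : IsGittinsStrategy ν v n π)
    (hn : 2 ≤ n) (μ : Fin d → ℝ) {k : Fin d} (hvi : 0 < v i) (hvk : 0 < v k) {D η : ℝ} (hD : 0 < D)
    (hη : 0 < η) :
    ∫⁻ h, (pulls h i : ℝ≥0∞) ∂(historyLaw π μ n) ≤
      ∑' s : ℕ, gaussianReal (s * μ i) s {y | 32 * Real.log n / D ^ 2 +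
        8 * ((v i : ℝ)⁻¹ * |μ i - ν i|) / D ≤ s → s * (D / 8) ≤ y - s * μ i} +
      ∑' s : ℕ, ∫⁻ y, failureBound η (ν k) (v k : ℝ)⁻¹ (μ i + D / 2) s y
        ∂(gaussianReal (s * μ k) s) := by
  rw [lintegral_pulls]
  refine le_trans ?_ (add_le_add
    (sum_setLIntegral_act_le π μ i n (B := fun s : ℕ => {y | 32 * Real.log n / D ^ 2 +
      8 * ((v i : ℝ)⁻¹ * |μ i - ν i|) / D ≤ s → s * (D / 8) ≤ y - s * μ i})
      fun s => by measurability)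
    (sum_historyLaw_remaining_le π μ k n (measurable_failureBound η (ν k) _ (μ i + D / 2))))
  rw [← Finset.sum_add_distrib]
  refine Finset.sum_le_sum fun t ht => lintegral_le_setLIntegral_add_measure
    (fun h => prob_le_one) fun h hact => ?_
  exact hπ.le_rewardSum_or_le_failureBound hn (Finset.mem_range.1 ht) hvi hvk hact hD hη

lemma tsum_gaussianReal_le (m : ℝ) {a ℓ : ℝ} (ha : 0 ≤ a) (hℓ : 0 ≤ ℓ) :
    ∑' s : ℕ, gaussianReal (s * m) s {y | ℓ ≤ s → s * a ≤ y - s * m} ≤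
      ENNReal.ofReal (ℓ + 1) + ∑' s : ℕ, ENNReal.ofReal (Real.exp (-(s * a ^ 2 / 2))) := by
  have hterm : ∀ s : ℕ, gaussianReal (s * m) s {y | ℓ ≤ s → s * a ≤ y - s * m} ≤
      (if s < ⌈ℓ⌉₊ then 1 else 0) + ENNReal.ofReal (Real.exp (-(s * a ^ 2 / 2))) := by
    intro s
    split_ifs with hs
    · exact le_add_right prob_le_one
    · simpa [Nat.ceil_le.1 (not_lt.1 hs)] using gaussianReal_tail_le (s * m) s ha
  have hcount : ∑' s : ℕ, (if s < ⌈ℓ⌉₊ then (1 : ℝ≥0∞) else 0) = ⌈ℓ⌉₊ := by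
    rw [tsum_eq_sum (s := Finset.range ⌈ℓ⌉₊) fun s hs => if_neg (Finset.mem_range.not.1 hs),
      Finset.sum_congr rfl fun s hs => if_pos (Finset.mem_range.1 hs)]
    simp
  refine (ENNReal.tsum_le_tsum hterm).trans ?_
  rw [ENNReal.tsum_add, hcount, ← ENNReal.ofReal_natCast]
  gcongr
  exact (Nat.ceil_lt_add_one hℓ).le

lemma exists_lintegral_pulls_le (hv : ∀ i, 0 < v i) (μ : Fin d → ℝ) (hi : 0 < gap μ i) :
    ∃ C : ℝ≥0∞, C ≠ ⊤ ∧ ∀ (n : ℕ) (π : Strategy d), 2 ≤ n → IsGittinsStrategy ν v n π →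
      ∫⁻ h, (pulls h i : ℝ≥0∞) ∂(historyLaw π μ n) ≤
        ENNReal.ofReal (32 * Real.log n / gap μ i ^ 2) + C := by
  have : Nonempty (Fin d) := ⟨i⟩
  obtain ⟨k, hk⟩ := exists_eq_ciSup_of_finite (f := μ)
  rw [gap, ← hk] at hi ⊢
  have hvk : 0 < v k := hv k
  have hG : ∑' s : ℕ, ENNReal.ofReal (Real.exp (-(s * ((μ k - μ i) / 8) ^ 2 / 2))) ≠ ⊤ := by
    refine Summable.tsum_ofReal_ne_top ((Real.summable_exp_nat_mul_iff.2
      (neg_lt_zero.2 (show 0 < ((μ k - μ i) / 8) ^ 2 / 2 by positivity))).congr fun s => ?_)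
    ring_nf
  have hF := tsum_lintegral_failureBound_ne_top (half_pos hi)
    (show 0 < (v k : ℝ)⁻¹ by positivity) (ν k) (μ k)
  rw [show μ k - (μ k - μ i) / 2 = μ i + (μ k - μ i) / 2 by ring] at hF
  refine ⟨_, ENNReal.add_ne_top.2 ⟨ENNReal.add_ne_top.2 ⟨ENNReal.ofReal_ne_top (r :=
    8 * ((v i : ℝ)⁻¹ * |μ i - ν i|) / (μ k - μ i) + 1), hG⟩, hF⟩, fun n π hn hπ => ?_⟩
  refine (lintegral_pulls_le_tsum_add_tsum hπ hn μ (hv i) hvk hi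
    (half_pos (half_pos hi))).trans ?_
  rw [← add_assoc, ← add_assoc, ← ENNReal.ofReal_add (by positivity) (by positivity), ← add_assoc]
  gcongr
  exact tsum_gaussianReal_le (μ i) (by positivity) (by positivity)

lemma exists_regret_le (hv : ∀ i, 0 < v i) (μ : Fin d → ℝ) :
    ∃ C : ℝ, ∀ (n : ℕ) (π : Strategy d), 2 ≤ n → IsGittinsStrategy ν v n π →
      regret π μ n ≤ 32 * (∑ i with 0 < gap μ i, 1 / gap μ i) * Real.log n + C := by
  have harm : ∀ i, ∃ C : ℝ, ∀ (n : ℕ) (π : Strategy d), 2 ≤ n → IsGittinsStrategy ν v n π →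
      gap μ i * (∫⁻ h, (pulls h i : ℝ≥0∞) ∂(historyLaw π μ n)).toReal ≤
        32 * (if 0 < gap μ i then 1 / gap μ i else 0) * Real.log n + C := by
    intro i
    by_cases hi : 0 < gap μ i
    · obtain ⟨C, hC, hle⟩ := exists_lintegral_pulls_le (ν := ν) hv μ hi
      refine ⟨gap μ i * C.toReal, fun n π hn hπ => ?_⟩
      have hreal := ENNReal.toReal_mono (ENNReal.add_ne_top.2 ⟨ENNReal.ofReal_ne_top, hC⟩)
        (hle n π hn hπ)
      rw [ENNReal.toReal_add ENNReal.ofReal_ne_top hC,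
        ENNReal.toReal_ofReal (by positivity)] at hreal
      rw [if_pos hi]
      refine (mul_le_mul_of_nonneg_left hreal hi.le).trans_eq ?_
      field_simp
    · refine ⟨0, fun n π _ _ => ?_⟩
      simp [le_antisymm (not_lt.1 hi) (gap_nonneg μ i)]
  choose C hC using harm
  refine ⟨∑ i, C i, fun n π hn hπ => ?_⟩
  rw [regret_eq]
  refine (Finset.sum_le_sum fun i _ => hC i n π hn hπ).trans_eq ?_
  rw [Finset.sum_add_distrib, ← Finset.sum_mul, ← Finset.mul_sum, Finset.sum_filter]

end Regret

end GaussianBandit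

theorem theorem3 :
    ∃ c : ℝ, 0 < c ∧
      ∀ (d : ℕ) (ν : Fin d → ℝ) (v : Fin d → ℝ≥0), (∀ i, 0 < v i) →
      ∀ π : ℕ → GaussianBandit.Strategy d,
        (∀ n, GaussianBandit.IsGittinsStrategy ν v n (π n)) →
      ∀ μ : Fin d → ℝ,
        limsup (fun n : ℕ => ((GaussianBandit.regret (π n) μ n / Real.log n : ℝ) : EReal)) atTop ≤
          ((c * ∑ i with 0 < GaussianBandit.gap μ i, 1 / GaussianBandit.gap μ i : ℝ) : EReal) := by
  refine ⟨32, by norm_num, fun d ν v hv π hπ μ => ?_⟩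
  obtain ⟨C, hC⟩ := GaussianBandit.exists_regret_le (ν := ν) hv μ
  refine GaussianBandit.limsup_div_le_of_eventually_le (C := C)
    (Real.tendsto_log_atTop.comp tendsto_natCast_atTop_atTop) ?_
  filter_upwards [eventually_ge_atTop 2] with n hn
  exact hC n (π n) hn (hπ n)
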